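/- There exist infinitely many essentially distinct pairs of triangles such that, in each pair, both triangles are nondegenerate, all six sides are squares of integers, the two triangles have the same perimeter and the same area, and the two triangles are not congruent. Here two pairs $\{S,T\}$ and $\{S',T'\}$ are regarded as essentially the same if $S$ is similar to $S'$ and $T$ to $T'$, or $S$ is similar to $T'$ and $T$ to $S'$ (since the triangles of a pair have equal perimeters, the two similarity ratios then agree, so one pair is a rescaling of the other). In other words, there is an infinite sequence of such pairs no two of which are essentially the same. -/

import Mathlib

/-- A (nondegenerate) triangle in the Euclidean plane: three affinely independent vertices. -/
abbrev PlaneTriangle : Type := Affine.Triangle ℝ (EuclideanSpace ℝ (Fin 2))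

namespace PlaneTriangle

/-- The perimeter: the sum of the three side lengths. -/
noncomputable def perimeter (T : PlaneTriangle) : ℝ :=
  dist (T.points 0) (T.points 1) + dist (T.points 1) (T.points 2) + dist (T.points 2) (T.points 0)

/-- The area: the Lebesgue measure of the convex hull of the three vertices. -/
noncomputable def area (T : PlaneTriangle) : ℝ :=
  MeasureTheory.volume.real (convexHull ℝ (Set.range T.points))

/-- Every side length is the square of an integer. -/
def HasSquareSides (T : PlaneTriangle) : Prop :=
  ∀ i j : Fin 3, i ≠ j → ∃ n : ℤ, dist (T.points i) (T.points j) = (n : ℝ) ^ 2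

/-- The triangles are congruent, for some correspondence of their vertices. -/
def IsCongruentTo (S T : PlaneTriangle) : Prop :=
  ∃ σ : Equiv.Perm (Fin 3), Congruent (S.points ∘ σ) T.points

/-- The triangles are similar, for some correspondence of their vertices. -/
def IsSimilarTo (S T : PlaneTriangle) : Prop :=
  ∃ σ : Equiv.Perm (Fin 3), Similar (S.points ∘ σ) T.points

end PlaneTriangle

/-- A pair of noncongruent triangles whose sides are squares of integers, with a common perimeter
and a common area. -/
structure IsSquareSidedPair (p : PlaneTriangle × PlaneTriangle) : Prop where
  squareSides_fst : p.1.HasSquareSides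
  squareSides_snd : p.2.HasSquareSides
  perimeter_eq : p.1.perimeter = p.2.perimeter
  area_eq : p.1.area = p.2.area
  not_congruent : ¬ p.1.IsCongruentTo p.2

/-- The two pairs agree up to similarity and the order of the triangles in a pair. When each pair
has a common perimeter, the two similarity ratios are automatically equal, so that one pair is
obtained from the other by a single rescaling. -/
def EssentiallySame (p q : PlaneTriangle × PlaneTriangle) : Prop :=
  (p.1.IsSimilarTo q.1 ∧ p.2.IsSimilarTo q.2) ∨ (p.1.IsSimilarTo q.2 ∧ p.2.IsSimilarTo q.1)

/-! ### Triangles: scaling invariants, and construction from side lengths. -/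

namespace PlaneTriangle

/-! Let the sides be the squares of a, b, c, with a + b + c = 18r and with a² + b² + c² even in n.
Negating n keeps both sums, hence also ab + bc + ca. By Heron the area then depends only on abc,
through a quadratic, and it is unchanged if the two values of abc add up to the right amount; this
condition is the cubic `OnCurve` (`OnCurve.prod_excess`).

Tangents give an orbit on the cubic. A point yields genuine triangles when r²/N ≥ 3/100, N being
`curveNorm`; below that threshold a tangent step multiplies r²/N by at least 6/5 (`OnCurve.growth`),
so the orbit reaches it infinitely often. The 2-adic valuation of r at step k is exactly k
(`orbit_parity`). It can be read off from the difference of the two side products divided by the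
cube of the perimeter, a similarity invariant of the pair up to sign, so different k give
essentially different pairs. -/

/-- The product of the three side lengths. -/
noncomputable def sideProd (T : PlaneTriangle) : ℝ :=
  dist (T.points 0) (T.points 1) * dist (T.points 1) (T.points 2) * dist (T.points 2) (T.points 0)

lemma perimeter_pos (T : PlaneTriangle) : 0 < T.perimeter := by
  have h : 0 < dist (T.points 0) (T.points 1) :=
    dist_pos.2 (T.independent.injective.ne (by decide))
  unfold perimeter
  positivity

lemma perimeter_and_sideProd_of_dist_eq {S T : PlaneTriangle} {ρ : ℝ} (σ : Equiv.Perm (Fin 3))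
    (h : ∀ i j, dist (S.points (σ i)) (S.points (σ j)) = ρ * dist (T.points i) (T.points j)) :
    S.perimeter = ρ * T.perimeter ∧ S.sideProd = ρ ^ 3 * T.sideProd := by
  have h01 := h 0 1
  have h12 := h 1 2
  have h20 := h 2 0
  have n01 : σ 0 ≠ σ 1 := σ.injective.ne (by decide)
  have n12 : σ 1 ≠ σ 2 := σ.injective.ne (by decide)
  have n20 : σ 2 ≠ σ 0 := σ.injective.ne (by decide)
  have hperm : S.perimeter = dist (S.points (σ 0)) (S.points (σ 1)) +
      dist (S.points (σ 1)) (S.points (σ 2)) + dist (S.points (σ 2)) (S.points (σ 0)) ∧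
      S.sideProd = dist (S.points (σ 0)) (S.points (σ 1)) *
      dist (S.points (σ 1)) (S.points (σ 2)) * dist (S.points (σ 2)) (S.points (σ 0)) := by
    unfold perimeter sideProd
    generalize σ 0 = a at *
    generalize σ 1 = b at *
    generalize σ 2 = c at *
    have c01 := dist_comm (S.points 1) (S.points 0)
    have c12 := dist_comm (S.points 2) (S.points 1)
    have c20 := dist_comm (S.points 0) (S.points 2)
    clear h h01 h12 h20
    fin_cases a <;> fin_cases b <;> fin_cases c <;> first
      | exact absurd rfl n01
      | exact absurd rfl n12
      | exact absurd rfl n20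
      | exact ⟨rfl, rfl⟩
      | (simp only [Fin.zero_eta, Fin.mk_one, Fin.reduceFinMk, c01, c12, c20]
         constructor <;> ring)
  rw [hperm.1, hperm.2, h01, h12, h20, perimeter, sideProd]
  constructor <;> ring

lemma IsSimilarTo.exists_ratio {S T : PlaneTriangle} (h : S.IsSimilarTo T) :
    ∃ ρ : ℝ, S.perimeter = ρ * T.perimeter ∧ S.sideProd = ρ ^ 3 * T.sideProd := by
  obtain ⟨σ, hσ⟩ := h
  obtain ⟨ρ, -, hρ⟩ := similar_iff_exists_pos_dist_eq.1 hσ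
  exact ⟨ρ, perimeter_and_sideProd_of_dist_eq σ hρ⟩

lemma IsCongruentTo.sideProd_eq {S T : PlaneTriangle} (h : S.IsCongruentTo T) :
    S.sideProd = T.sideProd := by
  obtain ⟨σ, hσ⟩ := h
  simpa using (perimeter_and_sideProd_of_dist_eq (ρ := 1) σ
    (by simpa using congruent_iff_dist_eq.1 hσ)).2

/-- The triangle with vertices `(0, 0)`, `(x, 0)` and `(u, v)`. -/
noncomputable def ofBase (x u v : ℝ) (hx : x ≠ 0) (hv : v ≠ 0) : PlaneTriangle where
  points := ![!₂[0, 0], !₂[x, 0], !₂[u, v]]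
  independent := by
    rw [affineIndependent_iff_of_fintype]
    intro w hw h
    rw [Finset.weightedVSub_eq_linear_combination _ hw] at h
    have h0 := congrArg (fun z : EuclideanSpace ℝ (Fin 2) => z 0) h
    have h1 := congrArg (fun z : EuclideanSpace ℝ (Fin 2) => z 1) h
    simp [Fin.sum_univ_three, hv] at h0 h1
    simp [h1, hx] at h0
    simp [Fin.sum_univ_three, h0, h1] at hw
    intro i
    fin_cases i <;> simp [hw, h0, h1]

/-- The linear map with columns `(x, 0)` and `(u, v)`. -/
noncomputable def shear (x u v : ℝ) : EuclideanSpace ℝ (Fin 2) →ₗ[ℝ] EuclideanSpace ℝ (Fin 2) :=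
  Matrix.toLpLin 2 2 !![x, u; 0, v]

lemma area_ofBase (x u v : ℝ) (hx : x ≠ 0) (hv : v ≠ 0) :
    (ofBase x u v hx hv).area = |x * v| * (ofBase 1 0 1 one_ne_zero one_ne_zero).area := by
  have h1 : Set.range (ofBase x u v hx hv).points =
      shear x u v '' Set.range (ofBase 1 0 1 one_ne_zero one_ne_zero).points := by
    rw [← Set.range_comp]
    congr 1
    ext i j
    fin_cases i <;> fin_cases j <;>
      simp [ofBase, shear, Matrix.toLpLin_apply]
  have h2 : LinearMap.det (shear x u v) = x * v := by
    rw [shear, Matrix.toLpLin_eq_toLin, LinearMap.det_toLin]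
    simp [Matrix.det_fin_two]
  unfold area
  rw [h1, ← LinearMap.image_convexHull, MeasureTheory.measureReal_def,
    MeasureTheory.Measure.addHaar_image_linearMap, h2, ENNReal.toReal_mul,
    ENNReal.toReal_ofReal (abs_nonneg _), MeasureTheory.measureReal_def]

/-- Heron's formula, up to a factor independent of the triangle, with the existence of a triangle
with given sides. -/
lemma exists_of_sides {x y z H : ℝ} (hx : 0 ≤ x) (hy : 0 ≤ y) (hz : 0 ≤ z) (hH : 0 < H)
    (h : H = (x + y + z) * ((x + y + z - 2 * x) * (x + y + z - 2 * y) * (x + y + z - 2 * z))) :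
    ∃ T : PlaneTriangle, dist (T.points 0) (T.points 1) = x ∧
      dist (T.points 1) (T.points 2) = y ∧ dist (T.points 2) (T.points 0) = z ∧
      T.area = √H / 2 * (ofBase 1 0 1 one_ne_zero one_ne_zero).area := by
  have hx0 : x ≠ 0 := by
    rintro rfl
    -- For x = 0 the Heron product is -(y + z)²(y - z)², which is not positive.
    nlinarith [sq_nonneg ((y + z) * (y - z))]
  have hs : √H ^ 2 = H := Real.sq_sqrt hH.le
  have hs0 : 0 < √H := Real.sqrt_pos.2 hH
  have hv : √H / (2 * x) ≠ 0 := by positivity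
  -- The apex comes from the law of cosines; its height is twice the area √H / 4 divided by the
  -- base.
  refine ⟨ofBase x ((x ^ 2 + z ^ 2 - y ^ 2) / (2 * x)) (√H / (2 * x)) hx0 hv, ?_, ?_, ?_, ?_⟩
  · simp [ofBase, EuclideanSpace.dist_eq, Real.dist_eq, hx]
  · simp only [ofBase, EuclideanSpace.dist_eq, Real.dist_eq, Fin.sum_univ_two, sq_abs]
    simp only [Matrix.cons_val]
    rw [Real.sqrt_eq_iff_mul_self_eq (by positivity) hy]
    field_simp
    linear_combination hs + h
  · simp only [ofBase, EuclideanSpace.dist_eq, Real.dist_eq, Fin.sum_univ_two, sq_abs]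
    simp only [Matrix.cons_val]
    rw [Real.sqrt_eq_iff_mul_self_eq (by positivity) hz]
    field_simp
    linear_combination hs + h
  · rw [area_ofBase]
    congr 1
    rw [abs_of_pos]
    · field_simp
    · have := lt_of_le_of_ne hx hx0.symm
      positivity

end PlaneTriangle

/-! ### The cubic curve and its tangent map. -/

/-- The norm of `n + t √-3`, for a triple `(r, t, n)`. -/
def curveNorm (p : ℤ × ℤ × ℤ) : ℤ := p.2.2 ^ 2 + 3 * p.2.1 ^ 2

/-- The real part of the cube of `n + t √-3`. -/
def curveTwist (p : ℤ × ℤ × ℤ) : ℤ := p.2.2 * (p.2.2 ^ 2 - 9 * p.2.1 ^ 2)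

/-- The triples `(r, t, n)` on a certain smooth plane cubic. -/
def OnCurve (p : ℤ × ℤ × ℤ) : Prop :=
  66 * p.1 ^ 3 + 38 * p.1 * curveNorm p - 45 * p.2.1 * (p.2.1 ^ 2 - p.2.2 ^ 2) = 0

/-- The third intersection of the curve with its tangent at a point. -/
def tangentStep (p : ℤ × ℤ × ℤ) : ℤ × ℤ × ℤ :=
  (-10 * p.1 * curveTwist p,
    -10 * curveNorm p * p.2.2 * p.2.1 + 44 * p.1 ^ 3 * p.2.2,
    5 * curveNorm p * (p.2.2 ^ 2 - 3 * p.2.1 ^ 2) - 132 * p.1 ^ 3 * p.2.1)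

lemma OnCurve.tangentStep {p : ℤ × ℤ × ℤ} (h : OnCurve p) : OnCurve (tangentStep p) := by
  obtain ⟨r, t, n⟩ := p
  simp only [OnCurve, _root_.tangentStep, curveNorm, curveTwist] at h ⊢
  linear_combination (-10 * (n * (n ^ 2 - 9 * t ^ 2)) * (25 * (n ^ 2 + 3 * t ^ 2) ^ 3 +
    3960 * r ^ 3 * t * (t ^ 2 - n ^ 2) + 5808 * r ^ 6)) * h

/-- The norm of (n + t√-3)³ is N³, and the equation of the curve expresses its imaginary part
through r and N. -/
lemma OnCurve.curveTwist_sq {p : ℤ × ℤ × ℤ} (h : OnCurve p) :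
    75 * curveTwist p ^ 2 =
      75 * curveNorm p ^ 3 - p.1 ^ 2 * (66 * p.1 ^ 2 + 38 * curveNorm p) ^ 2 := by
  obtain ⟨r, t, n⟩ := p
  simp only [OnCurve, curveNorm, curveTwist] at h ⊢
  linear_combination (-(66 * r ^ 3 + 38 * r * (n ^ 2 + 3 * t ^ 2)) -
    45 * t * (t ^ 2 - n ^ 2)) * -h

lemma OnCurve.curveNorm_tangentStep {p : ℤ × ℤ × ℤ} (h : OnCurve p) :
    curveNorm (_root_.tangentStep p) = curveNorm p *
      (25 * curveNorm p ^ 3 + 3344 * p.1 ^ 4 * curveNorm p + 11616 * p.1 ^ 6) := by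
  obtain ⟨r, t, n⟩ := p
  simp only [OnCurve, _root_.tangentStep, curveNorm, curveTwist] at h ⊢
  linear_combination (-88 * r ^ 3 * (n ^ 2 + 3 * t ^ 2)) * h

/-! ### The orbit: 2-adic behaviour and growth. -/

/-- The iterated tangents from a point of the curve. -/
def orbit (k : ℕ) : ℤ × ℤ × ℤ := tangentStep^[k] (27, 104, 53)

lemma orbit_succ (k : ℕ) : orbit (k + 1) = tangentStep (orbit k) :=
  Function.iterate_succ_apply' _ _ _

lemma onCurve_orbit (k : ℕ) : OnCurve (orbit k) := by
  induction k with
  | zero => norm_num [orbit, OnCurve, curveNorm]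
  | succ k ih => rw [orbit_succ]; exact ih.tangentStep

lemma orbit_parity (k : ℕ) :
    Odd (orbit k).2.2 ∧ Even (orbit k).2.1 ∧ ∃ w, Odd w ∧ (orbit k).1 = 2 ^ k * w := by
  induction k with
  | zero => exact ⟨by decide, by decide, 27, by decide, by norm_num [orbit]⟩
  | succ k ih =>
    rw [orbit_succ]
    obtain ⟨hn, ht, w, hw, hr⟩ := ih
    generalize orbit k = p at *
    obtain ⟨r, t, n⟩ := p
    simp only [tangentStep, curveNorm, curveTwist] at *
    -- The new r is -10 r times the odd `curveTwist`, so it gains exactly one factor 2.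
    refine ⟨?_, ?_, -5 * w * (n * (n ^ 2 - 9 * t ^ 2)), ?_, ?_⟩
    · simp [parity_simps, ← Int.not_even_iff_odd, show Even (132 : ℤ) by decide,
        show ¬ Even (5 : ℤ) by decide, show ¬ Even (3 : ℤ) by decide] at *
      simp [*]
    · simp [parity_simps, show Even (10 : ℤ) by decide, show Even (44 : ℤ) by decide]
    · simp [parity_simps, ← Int.not_even_iff_odd, show ¬ Even (5 : ℤ) by decide] at *
      simp [*]
    · rw [hr]; ring

lemma curveNorm_odd (k : ℕ) : Odd (curveNorm (orbit k)) := by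
  obtain ⟨hn, ht, -⟩ := orbit_parity k
  simp [curveNorm, parity_simps, ← Int.not_even_iff_odd] at *
  simp [*]

lemma curveTwist_odd (k : ℕ) : Odd (curveTwist (orbit k)) := by
  obtain ⟨hn, ht, -⟩ := orbit_parity k
  simp [curveTwist, parity_simps, ← Int.not_even_iff_odd] at *
  simp [*]

lemma curveNorm_pos (k : ℕ) : 0 < curveNorm (orbit k) := by
  refine lt_of_le_of_ne ?_ fun h => ?_
  · unfold curveNorm; positivity
  · have := curveNorm_odd k
    rw [← h] at this
    exact absurd this (by decide)

lemma orbit_fst_ne_zero (k : ℕ) : (orbit k).1 ≠ 0 := by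
  obtain ⟨-, -, w, hw, h⟩ := orbit_parity k
  rw [h]
  have : w ≠ 0 := by rintro rfl; exact absurd hw (by decide)
  positivity

lemma OnCurve.growth {p : ℤ × ℤ × ℤ} (h : OnCurve p) (hN : 0 < curveNorm p)
    (hp : 100 * p.1 ^ 2 < 3 * curveNorm p) :
    6 * (p.1 ^ 2 * curveNorm (_root_.tangentStep p)) ≤
      5 * ((_root_.tangentStep p).1 ^ 2 * curveNorm p) := by
  have hQ := h.curveTwist_sq
  rw [h.curveNorm_tangentStep]
  have h1 : (_root_.tangentStep p).1 ^ 2 = 100 * p.1 ^ 2 * curveTwist p ^ 2 := by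
    simp only [_root_.tangentStep]; ring
  rw [h1]
  have hR : 0 ≤ p.1 ^ 2 := sq_nonneg _
  have e4 : p.1 ^ 4 = (p.1 ^ 2) ^ 2 := by ring
  have e6 : p.1 ^ 6 = (p.1 ^ 2) ^ 3 := by ring
  rw [e4, e6]
  generalize p.1 ^ 2 = R at *
  generalize curveNorm p = N at *
  generalize curveTwist p ^ 2 = W at *
  have k1 : 0 ≤ R * (3 * N - 100 * R) := mul_nonneg hR (by linarith)
  have k2 : 0 ≤ R * N * (3 * N - 100 * R) := mul_nonneg (by positivity) (by linarith)
  have k3 : 0 ≤ R * R * (3 * N - 100 * R) := mul_nonneg (by positivity) (by linarith)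
  have k4 : 0 ≤ N * N * (3 * N - 100 * R) := mul_nonneg (by positivity) (by linarith)
  have key : 6 * (25 * N ^ 3 + 3344 * R ^ 2 * N + 11616 * R ^ 3) ≤ 500 * W := by
    nlinarith [pow_pos hN 3]
  have : 0 ≤ R * N := by positivity
  nlinarith [mul_le_mul_of_nonneg_left key this]

lemma frequently_large (m : ℕ) :
    ∃ k ≥ m, 3 * curveNorm (orbit k) ≤ 100 * (orbit k).1 ^ 2 := by
  by_contra! hc
  let v : ℕ → ℝ := fun k => ((orbit k).1 : ℝ) ^ 2 / curveNorm (orbit k)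
  have hNpos : ∀ k, (0 : ℝ) < curveNorm (orbit k) := fun k => by exact_mod_cast curveNorm_pos k
  have hv : ∀ j, (6 / 5 : ℝ) ^ j * v m ≤ v (m + j) := by
    intro j
    induction j with
    | zero => simp
    | succ j ih =>
      have hg := (onCurve_orbit (m + j)).growth (curveNorm_pos _) (hc (m + j) (by omega))
      rw [← orbit_succ] at hg
      have hg' : (6 : ℝ) * (((orbit (m + j)).1 : ℝ) ^ 2 * curveNorm (orbit (m + j + 1))) ≤
        5 * (((orbit (m + j + 1)).1 : ℝ) ^ 2 * curveNorm (orbit (m + j))) := by exact_mod_cast hg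
      have : (6 / 5 : ℝ) * v (m + j) ≤ v (m + j + 1) := by
        simp only [v]
        rw [← mul_div_assoc, div_le_div_iff₀ (hNpos _) (hNpos _)]
        linarith
      calc (6 / 5 : ℝ) ^ (j + 1) * v m = 6 / 5 * ((6 / 5 : ℝ) ^ j * v m) := by ring
        _ ≤ 6 / 5 * v (m + j) := by gcongr
        _ ≤ _ := this
  have hvm : 0 < v m := by
    have : ((orbit m).1 : ℝ) ≠ 0 := by exact_mod_cast orbit_fst_ne_zero m
    exact div_pos (by positivity) (hNpos m)
  obtain ⟨j, hj⟩ := pow_unbounded_of_one_lt (1 / v m) (by norm_num : (1 : ℝ) < 6 / 5)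
  have h1 : 1 < v (m + j) := ((div_lt_iff₀ hvm).1 hj).trans_le (hv j)
  have h2 : (100 : ℝ) * ((orbit (m + j)).1 : ℝ) ^ 2 < 3 * curveNorm (orbit (m + j)) := by
    exact_mod_cast hc (m + j) (by omega)
  simp only [v] at h1
  rw [lt_div_iff₀ (hNpos _)] at h1
  linarith [hNpos (m + j)]

/-! ### The pair of triangles of a point. -/

/-- The roots of the side lengths of the first triangle belonging to a point of the curve. -/
def sideRoot (p : ℤ × ℤ × ℤ) : Fin 3 → ℤ :=
  ![6 * p.1 + 9 * p.2.1 + 7 * p.2.2, 6 * p.1 - 15 * p.2.1 + p.2.2, 6 * p.1 + 6 * p.2.1 - 8 * p.2.2]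

/-- The point with its last coordinate negated, which gives the second triangle of a pair. -/
def conjPoint (p : ℤ × ℤ × ℤ) : ℤ × ℤ × ℤ := (p.1, p.2.1, -p.2.2)

/-- A third of the semiperimeter of the triangles belonging to a point of the curve. -/
def sizeForm (p : ℤ × ℤ × ℤ) : ℤ := 18 * p.1 ^ 2 + 19 * curveNorm p

lemma OnCurve.conjPoint {p : ℤ × ℤ × ℤ} (h : OnCurve p) : OnCurve (conjPoint p) := by
  simpa [OnCurve, _root_.conjPoint, curveNorm] using h

@[simp] lemma sizeForm_conjPoint (p : ℤ × ℤ × ℤ) : sizeForm (conjPoint p) = sizeForm p := by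
  simp [sizeForm, conjPoint, curveNorm]

lemma sum_sideRoot_sq (p : ℤ × ℤ × ℤ) :
    sideRoot p 0 ^ 2 + sideRoot p 1 ^ 2 + sideRoot p 2 ^ 2 = 6 * sizeForm p := by
  simp [sideRoot, sizeForm, curveNorm]; ring

lemma prod_sideRoot_sub (p : ℤ × ℤ × ℤ) :
    sideRoot p 0 * sideRoot p 1 * sideRoot p 2 -
      sideRoot (conjPoint p) 0 * sideRoot (conjPoint p) 1 * sideRoot (conjPoint p) 2 = -112 * curveTwist p := by
  simp [sideRoot, conjPoint, curveTwist]; ring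

lemma OnCurve.prod_sideRoot_add {p : ℤ × ℤ × ℤ} (h : OnCurve p) :
    sideRoot p 0 * sideRoot p 1 * sideRoot p 2 +
      sideRoot (_root_.conjPoint p) 0 * sideRoot (_root_.conjPoint p) 1 * sideRoot (_root_.conjPoint p) 2 =
        -108 * p.1 * sizeForm p := by
  simp [sideRoot, _root_.conjPoint, sizeForm, OnCurve, curveNorm] at *
  linear_combination 36 * h

lemma OnCurve.prod_excess {p : ℤ × ℤ × ℤ} (h : OnCurve p) :
    (6 * sizeForm p - 2 * sideRoot p 0 ^ 2) * (6 * sizeForm p - 2 * sideRoot p 1 ^ 2) *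
      (6 * sizeForm p - 2 * sideRoot p 2 ^ 2) =
        629856 * p.1 ^ 4 * sizeForm p - 25088 * curveTwist p ^ 2 := by
  have h1 := h.prod_sideRoot_add
  have h2 := prod_sideRoot_sub p
  have h3 := sum_sideRoot_sq p
  have h4 : sideRoot p 0 + sideRoot p 1 + sideRoot p 2 = 18 * p.1 := by
    simp [sideRoot]; ring
  have h5 : sideRoot p 0 * sideRoot p 1 + sideRoot p 0 * sideRoot p 2 + sideRoot p 1 * sideRoot p 2
      = 162 * p.1 ^ 2 - 3 * sizeForm p := by
    simp [sideRoot, sizeForm, curveNorm]; ring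
  have h6 (a b c S : ℤ) (h : a ^ 2 + b ^ 2 + c ^ 2 = S) :
      (S - 2 * a ^ 2) * (S - 2 * b ^ 2) * (S - 2 * c ^ 2) =
        -S ^ 3 + 4 * S * (a * b + a * c + b * c) ^ 2 - 8 * S * (a + b + c) * (a * b * c)
          - 8 * (a * b * c) ^ 2 := by
    subst h; ring
  rw [h6 _ _ _ _ h3, h4, h5]
  generalize sideRoot p 0 * sideRoot p 1 * sideRoot p 2 = x at *
  have h7 : (2 * x + 108 * p.1 * sizeForm p) ^ 2 = (-112 * curveTwist p) ^ 2 := by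
    rw [show 2 * x + 108 * p.1 * sizeForm p = -112 * curveTwist p by linarith]
  -- Completing the square in abc leaves only the square of half the difference of the two products,
  -- which is even in n.
  linear_combination -2 * h7

lemma OnCurve.prod_excess_pos {p : ℤ × ℤ × ℤ} (h : OnCurve p) (hN : 0 < curveNorm p)
    (hp : 3 * curveNorm p ≤ 100 * p.1 ^ 2) :
    0 < (6 * sizeForm p - 2 * sideRoot p 0 ^ 2) * (6 * sizeForm p - 2 * sideRoot p 1 ^ 2) *
      (6 * sizeForm p - 2 * sideRoot p 2 ^ 2) := by
  rw [h.prod_excess]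
  have hQ := h.curveTwist_sq
  have e4 : p.1 ^ 4 = (p.1 ^ 2) ^ 2 := by ring
  rw [e4, sizeForm]
  -- In N and the slack e, the cleared polynomial has only positive coefficients.
  obtain ⟨e, he⟩ : ∃ e, e = 100 * p.1 ^ 2 - 3 * curveNorm p := ⟨_, rfl⟩
  have he0 : 0 ≤ e := by linarith
  have hR : 100 * p.1 ^ 2 = 3 * curveNorm p + e := by linarith
  generalize p.1 ^ 2 = R at *
  generalize curveNorm p = N at *
  generalize curveTwist p ^ 2 = W at *
  have key : 0 < 1000000 * (75 * (629856 * R ^ 2 * (18 * R + 19 * N) - 25088 * W)) := by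
    have : 1000000 * (75 * (629856 * R ^ 2 * (18 * R + 19 * N) - 25088 * W)) =
        75 * (629856 * (100 * R) ^ 2 * (18 * (100 * R) + 1900 * N)) - 25088 * (75000000 * N ^ 3
          - (100 * R) * (66 * (100 * R) + 3800 * N) ^ 2) := by
      linear_combination -25088000000 * hQ
    rw [this, hR]
    have hexp : 75 * (629856 * (3 * N + e) ^ 2 * (18 * (3 * N + e) + 1900 * N)) -
        25088 * (75000000 * N ^ 3 - (3 * N + e) * (66 * (3 * N + e) + 3800 * N) ^ 2) =
        152168648256 * N ^ 3 + 1002211345856 * (N ^ 2 * e) + 110974921152 * (N * e ^ 2) + 959588928 * e ^ 3 := by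
      ring
    rw [hexp]
    positivity
  linarith

lemma OnCurve.exists_triangle {p : ℤ × ℤ × ℤ} (h : OnCurve p) (hN : 0 < curveNorm p)
    (hp : 3 * curveNorm p ≤ 100 * p.1 ^ 2) :
    ∃ T : PlaneTriangle, T.HasSquareSides ∧ T.perimeter = 6 * sizeForm p ∧
      T.sideProd = (sideRoot p 0 * sideRoot p 1 * sideRoot p 2 : ℝ) ^ 2 ∧
      T.area = √(6 * sizeForm p *
        (629856 * p.1 ^ 4 * sizeForm p - 25088 * curveTwist p ^ 2) : ℝ) / 2 *
        (PlaneTriangle.ofBase 1 0 1 one_ne_zero one_ne_zero).area := by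
  have hs : (sideRoot p 0 ^ 2 + sideRoot p 1 ^ 2 + sideRoot p 2 ^ 2 : ℝ) = 6 * sizeForm p := by
    exact_mod_cast sum_sideRoot_sq p
  have he := h.prod_excess_pos hN hp
  have hM : (0 : ℝ) < sizeForm p := by
    have : 0 < sizeForm p := by unfold sizeForm; positivity
    exact_mod_cast this
  have he2 := h.prod_excess
  rw [he2] at he
  have he' : (0 : ℝ) < 629856 * p.1 ^ 4 * sizeForm p - 25088 * curveTwist p ^ 2 := by
    exact_mod_cast he
  have he2' : ((6 * sizeForm p - 2 * sideRoot p 0 ^ 2) * (6 * sizeForm p - 2 * sideRoot p 1 ^ 2) *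
      (6 * sizeForm p - 2 * sideRoot p 2 ^ 2) : ℝ) =
        629856 * p.1 ^ 4 * sizeForm p - 25088 * curveTwist p ^ 2 := by exact_mod_cast he2
  obtain ⟨T, h0, h1, h2, hT⟩ := PlaneTriangle.exists_of_sides
    (sq_nonneg (sideRoot p 0 : ℝ)) (sq_nonneg (sideRoot p 1 : ℝ)) (sq_nonneg (sideRoot p 2 : ℝ))
    (mul_pos (mul_pos (by norm_num : (0 : ℝ) < 6) hM) he') (by rw [hs, he2'])
  refine ⟨T, ?_, ?_, ?_, hT⟩
  · intro i j hij
    fin_cases i <;> fin_cases j <;> first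
      | exact absurd rfl hij
      | exact ⟨_, h0⟩
      | exact ⟨_, h1⟩
      | exact ⟨_, h2⟩
      | exact ⟨_, (dist_comm _ _).trans h0⟩
      | exact ⟨_, (dist_comm _ _).trans h1⟩
      | exact ⟨_, (dist_comm _ _).trans h2⟩
  · rw [PlaneTriangle.perimeter, h0, h1, h2, hs]
  · rw [PlaneTriangle.sideProd, h0, h1, h2]
    ring

lemma exists_pair {k : ℕ} (hk : 3 * curveNorm (orbit k) ≤ 100 * (orbit k).1 ^ 2) :
    ∃ p : PlaneTriangle × PlaneTriangle, IsSquareSidedPair p ∧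
      p.1.perimeter = 6 * sizeForm (orbit k) ∧
      p.1.sideProd - p.2.sideProd =
        12096 * ((orbit k).1 * curveTwist (orbit k) * sizeForm (orbit k) : ℤ) := by
  have h := onCurve_orbit k
  have hN := curveNorm_pos k
  have hN' : curveNorm (conjPoint (orbit k)) = curveNorm (orbit k) := by
    simp [curveNorm, conjPoint]
  obtain ⟨S, hS, hSp, hSq, hSa⟩ := h.exists_triangle hN hk
  obtain ⟨T, hT, hTp, hTq, hTa⟩ := h.conjPoint.exists_triangle (hN' ▸ hN) (hN' ▸ hk)
  have hd : S.sideProd - T.sideProd =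
      12096 * ((orbit k).1 * curveTwist (orbit k) * sizeForm (orbit k) : ℤ) := by
    rw [hSq, hTq]
    norm_cast
    have h1 := h.prod_sideRoot_add
    have h2 := prod_sideRoot_sub (orbit k)
    rw [sq_sub_sq, h1, h2]
    ring
  have hM : sizeForm (orbit k) ≠ 0 := by
    have : 0 < sizeForm (orbit k) := by unfold sizeForm; positivity
    exact this.ne'
  have hQ : curveTwist (orbit k) ≠ 0 := fun h0 => by simpa [h0] using curveTwist_odd k
  rw [sizeForm_conjPoint] at hTp
  refine ⟨(S, T), ⟨hS, hT, hSp.trans hTp.symm, ?_, fun hc => ?_⟩, hSp, hd⟩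
  · rw [hSa, hTa, sizeForm_conjPoint]
    have hQ' : (curveTwist (conjPoint (orbit k)) : ℝ) ^ 2 = curveTwist (orbit k) ^ 2 := by
      simp [curveTwist, conjPoint, mul_pow]
    rw [hQ']
    rfl
  · rw [hc.sideProd_eq, sub_self, eq_comm] at hd
    have : (orbit k).1 * curveTwist (orbit k) * sizeForm (orbit k) = 0 := by
      have := (mul_eq_zero.1 hd).resolve_left (by norm_num)
      exact_mod_cast this
    simp [hM, hQ, orbit_fst_ne_zero] at this

/-! ### Distinct indices give essentially distinct pairs. -/

lemma Int.pow_mul_odd_injective {m n : ℕ} {a b : ℤ} (ha : Odd a) (hb : Odd b)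
    (h : 4 ^ m * a = 4 ^ n * b) : m = n := by
  wlog hmn : m ≤ n generalizing m n a b
  · exact (this hb ha h.symm (by omega)).symm
  obtain ⟨d, rfl⟩ := Nat.exists_eq_add_of_le hmn
  rw [pow_add, mul_assoc] at h
  have h1 := mul_left_cancel₀ (by positivity) h
  rcases d with _ | d
  · rfl
  · have : Even a := by
      rw [h1, pow_succ]
      simp [parity_simps, show Even (4 : ℤ) by decide]
    exact absurd ha (Int.not_odd_iff_even.2 this)

lemma sizeForm_odd (k : ℕ) : Odd (sizeForm (orbit k)) := by
  have := curveNorm_odd k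
  simp [sizeForm, parity_simps, ← Int.not_even_iff_odd, show Even (18 : ℤ) by decide,
    show ¬ Even (19 : ℤ) by decide] at *
  simp [*]

/-- Squaring in `hD` absorbs the sign change when the triangles of a pair are swapped. Eliminating ρ
leaves 4^m and 4^n times odd integers. -/
lemma index_eq_of_ratio {m n : ℕ} {ρ : ℝ}
    (hP : (6 * sizeForm (orbit m) : ℝ) = ρ * (6 * sizeForm (orbit n)))
    (hD : (12096 * ((orbit m).1 * curveTwist (orbit m) * sizeForm (orbit m) : ℤ) : ℝ) ^ 2 =
      (ρ ^ 3 * (12096 * ((orbit n).1 * curveTwist (orbit n) * sizeForm (orbit n) : ℤ))) ^ 2) :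
    m = n := by
  obtain ⟨-, -, w, hw, hr⟩ := orbit_parity m
  obtain ⟨-, -, w', hw', hr'⟩ := orbit_parity n
  have hQ := curveTwist_odd m
  have hQ' := curveTwist_odd n
  have hM := sizeForm_odd m
  have hM' := sizeForm_odd n
  rw [hr, hr'] at hD
  generalize curveTwist (orbit m) = q at *
  generalize curveTwist (orbit n) = q' at *
  generalize sizeForm (orbit m) = s at *
  generalize sizeForm (orbit n) = s' at *
  have hs : (s : ℝ) = ρ * s' := by linarith
  refine Int.pow_mul_odd_injective (a := (w * q * s) ^ 2 * s' ^ 6) (b := (w' * q' * s') ^ 2 * s ^ 6)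
    (((hw.mul hQ).mul hM).pow.mul hM'.pow) (((hw'.mul hQ').mul hM').pow.mul hM.pow) ?_
  have e (j : ℕ) : (4 : ℝ) ^ j = (2 ^ j) ^ 2 := by rw [← pow_mul, mul_comm, pow_mul]; norm_num
  have : ((4 : ℝ) ^ m * ((w * q * s) ^ 2 * s' ^ 6)) = 4 ^ n * ((w' * q' * s') ^ 2 * s ^ 6) := by
    push_cast at hD
    rw [e, e]
    have hD' : ((2 : ℝ) ^ m * w * q * s) ^ 2 = (ρ ^ 3 * (2 ^ n * w' * q' * s')) ^ 2 := by
      linear_combination hD / 12096 ^ 2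
    have h6 : (s : ℝ) ^ 6 = ρ ^ 6 * s' ^ 6 := by rw [hs]; ring
    rw [h6]
    linear_combination (s' : ℝ) ^ 6 * hD'
  exact_mod_cast this

theorem mainTheorem2 :
    ∃ P : ℕ → PlaneTriangle × PlaneTriangle,
      (∀ n : ℕ, IsSquareSidedPair (P n)) ∧
      (∀ m n : ℕ, m ≠ n → ¬ EssentiallySame (P m) (P n)) := by
  obtain ⟨φ, hφ, hlarge⟩ := Filter.extraction_of_frequently_atTop
    (Filter.frequently_atTop.2 frequently_large)
  choose P hP hP1 hPd using fun n => exists_pair (hlarge n)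
  refine ⟨P, hP, fun m n hmn hsame => hmn (hφ.injective ?_)⟩
  have hne : (P n).1.perimeter ≠ 0 := (P n).1.perimeter_pos.ne'
  have hpn : (P n).2.perimeter = (P n).1.perimeter := (hP n).perimeter_eq.symm
  have hpm : (P m).2.perimeter = (P m).1.perimeter := (hP m).perimeter_eq.symm
  rcases hsame with ⟨h1, h2⟩ | ⟨h1, h2⟩ <;>
  · obtain ⟨ρ, hρ, hρ'⟩ := h1.exists_ratio
    obtain ⟨τ, hτ, hτ'⟩ := h2.exists_ratio
    have : τ = ρ := by
      simp only [hpn, hpm] at hρ hτ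
      exact mul_right_cancel₀ hne (hτ.symm.trans hρ)
    subst this
    refine index_eq_of_ratio (ρ := τ) ?_ ?_
    · rw [← hP1, ← hP1]
      simpa only [hpn, hpm] using hρ
    · rw [← hPd, ← hPd, hρ', hτ']
      ring
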